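/- **Setting.** Let $\mathcal K=\{1,\dots,K\}$ be a finite set of actions. On a probability space $(\Omega,\mathcal F,\mathbb P)$ let $p^*$ be a random probability distribution on $[0,1]^{K}$ (drawn from an arbitrary prior), and let $\boldsymbol Y_t=(Y_{t,a})_{a\in\mathcal K}\in[0,1]^K$, $t\ge 1$, be reward vectors that, conditionally on $p^*$, are independent and identically distributed with law $p^*$. Let $A^*$ be an optimal action, i.e. a measurable function of $p^*$ with $A^*\in\arg\max_{a\in\mathcal K}\mathbb E[Y_{t,a}\mid p^*]$ almost surely. Let $G_1,G_2,\dots$ be an arbitrary deterministic sequence of directed graphs on $\mathcal K$, each of which contains all self-loops; write $j\overset{t}{\to}i$ if $(j,i)$ is an arc of $G_t$. In round $t$ the decision maker plays an action $A_t$ and observes $Y_{t,a}$ for all $a$ with $A_t\overset{t}{\to}a$. Let $\mathcal F_t$ be the $\sigma$-algebra generated by the actions and observations of rounds $1,\dots,t-1$, let $\boldsymbol\alpha_t(a)=\mathbb P(A^*=a\mid\mathcal F_t)$ be the posterior distribution of $A^*$ (so $\boldsymbol\alpha_1$ is its prior distribution), let $H(\boldsymbol\alpha_1)=-\sum_{a}\boldsymbol\alpha_1(a)\log\boldsymbol\alpha_1(a)$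 be its Shannon entropy (natural logarithm, $0\log 0=0$), and for a probability vector $\boldsymbol\pi$ on $\mathcal K$ put $$Q_t(\boldsymbol\pi)=\sum_{i\in\mathcal K}\frac{\boldsymbol\pi(i)}{\sum_{j:\,j\overset{t}{\to}i}\boldsymbol\pi(j)}\qquad(\text{with } 0/0=0).$$ The algorithm TS-N (Thompson Sampling without knowledge of the graphs) draws $A_t$ from $\boldsymbol\pi_t=\boldsymbol\alpha_t$ in every round $t$, with randomness that is conditionally independent of $(p^*,\boldsymbol Y_1,\boldsymbol Y_2,\dots)$ given $\mathcal F_t$; that is, $\mathbb P(A_t=a\mid\mathcal F_t,p^*,\boldsymbol Y_1,\boldsymbol Y_2,\dots)=\boldsymbol\alpha_t(a)$ almost surely for all $a$. **Theorem.** For every $T\ge 0$, the Bayesian regret of TS-N satisfies $$\mathbb E\Big[\sum_{t=1}^{T}\big(Y_{t,A^*}-Y_{t,A_t}\big)\Big]\;\le\;\sqrt{\frac12\Big(\sum_{t=1}^{T}\mathbb E\big[Q_t(\boldsymbol\alpha_t)\big]\Big)\,H(\boldsymbol\alpha_1)}\,.$$ -/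

import Mathlib

open MeasureTheory ProbabilityTheory
open scoped BigOperators

noncomputable section

/-- A reward vector `(y_a)_a`, one reward in `[0,1]` for each of the `K` actions. -/
abbrev RewardVec (K : ℕ) : Type := Fin K → unitInterval

/-- The Shannon entropy (natural logarithm, `0 log 0 = 0`) of a vector of probabilities. -/
def shannonEntropy {K : ℕ} (q : Fin K → ℝ) : ℝ :=
  -∑ i, q i * Real.log (q i)

open Classical in
/-- `Q_G(q) = ∑ i, q i / ∑_{j → i in G} q j`, where a summand `0 / 0` counts as `0`. -/
def graphQ {K : ℕ} (G : Digraph (Fin K)) (q : Fin K → ℝ) : ℝ :=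
  ∑ i, q i / ∑ j ∈ Finset.univ.filter (fun j => G.Adj j i), q j

/-- The mean reward of action `a` under the reward distribution `p`. -/
def meanReward {K : ℕ} (p : Measure (RewardVec K)) (a : Fin K) : ℝ :=
  ∫ y, (y a : ℝ) ∂p

/-- The objects of a `K`-armed bandit with graph feedback, over a sample space `Ω`.
Rounds are numbered `0, 1, 2, …`. -/
structure GraphBandit (K : ℕ) (Ω : Type*) where
  /-- the (deterministic, latent, directed) feedback graph of round `t`: an arc `i → j` means that
  playing `i` reveals the reward of `j` -/
  graph : ℕ → Digraph (Fin K)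
  /-- the random true reward distribution `p*` -/
  pstar : Ω → Measure (RewardVec K)
  /-- the reward vector `Y_t` of round `t` -/
  reward : ℕ → Ω → RewardVec K
  /-- the optimal action `A*` -/
  optAction : Ω → Fin K
  /-- the action `A_t` played in round `t` -/
  action : ℕ → Ω → Fin K

namespace GraphBandit

variable {K : ℕ} {Ω : Type*}

/-- The σ-algebra generated by the true reward distribution `p*`. -/
abbrev sigmaPstar (B : GraphBandit K Ω) : MeasurableSpace Ω :=
  MeasurableSpace.comap B.pstar inferInstance

/-- The σ-algebra generated by `p*` and all the reward vectors (observed or not). -/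
abbrev sigmaEnv (B : GraphBandit K Ω) : MeasurableSpace Ω :=
  B.sigmaPstar ⊔ ⨆ s, MeasurableSpace.comap (B.reward s) inferInstance

open Classical in
/-- What the decision maker sees in round `s`: the action `A_s`, and `Y_{s,a}` for every `a` with
`A_s → a`. The entries of the other actions are blanked out (set to `0`). As the graph is
deterministic, `A_s` determines which entries these are, so the filler carries no information. -/
def observation (B : GraphBandit K Ω) (s : ℕ) (ω : Ω) : Fin K × RewardVec K :=
  (B.action s ω, fun a => if (B.graph s).Adj (B.action s ω) a then B.reward s ω a else 0)

/-- The σ-algebra `F_t` generated by the observations of all the rounds before `t`. -/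
abbrev hist (B : GraphBandit K Ω) (t : ℕ) : MeasurableSpace Ω :=
  ⨆ s : Fin t, MeasurableSpace.comap (B.observation s) inferInstance

variable [MeasurableSpace Ω]

/-- The assumptions of the Bayesian bandit model with graph feedback. -/
structure IsBayesian (B : GraphBandit K Ω) (P : Measure Ω) : Prop where
  /-- every graph contains all the self-loops: the reward of the played action is observed -/
  adj_self : ∀ t i, (B.graph t).Adj i i
  measurable_pstar : Measurable B.pstar
  isProbabilityMeasure_pstar : ∀ ω, IsProbabilityMeasure (B.pstar ω)
  measurable_reward : ∀ t, Measurable (B.reward t)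
  measurable_action : ∀ t, Measurable (B.action t)
  /-- conditionally on `p*`, the reward vectors are independent and all have the law `p*` -/
  iid_reward : ∀ (n : ℕ) (S : ℕ → Set (RewardVec K)), (∀ t, MeasurableSet (S t)) →
    P⟦⋂ t ∈ Finset.range n, B.reward t ⁻¹' S t | B.sigmaPstar⟧
      =ᵐ[P] fun ω => ∏ t ∈ Finset.range n, (B.pstar ω).real (S t)
  /-- `A*` is a function of `p*` … -/
  measurable_optAction : Measurable[B.sigmaPstar] B.optAction
  /-- … and it maximizes the mean reward under `p*` -/
  optAction_optimal : ∀ᵐ ω ∂P, ∀ a,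
    meanReward (B.pstar ω) a ≤ meanReward (B.pstar ω) (B.optAction ω)

/-- The prior distribution of `A*`. -/
def prior (B : GraphBandit K Ω) (P : Measure Ω) (a : Fin K) : ℝ :=
  P.real (B.optAction ⁻¹' {a})

/-- The posterior distribution `α_t(a) = ℙ(A* = a | F_t)` of `A*` at the start of round `t`. -/
def posterior (B : GraphBandit K Ω) (P : Measure Ω) (t : ℕ) (a : Fin K) : Ω → ℝ :=
  P⟦B.optAction ⁻¹' {a} | B.hist t⟧

/-- The actions are drawn from the randomized policy `π`: `π_t` is `F_t`-measurable, and `A_t` is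
drawn from `π_t` with randomness that depends on the environment `(p*, Y_0, Y_1, …)` only through
the history, i.e. `ℙ(A_t = a | F_t, p*, Y_0, Y_1, …) = π_t(a) = ℙ(A_t = a | F_t)`. -/
structure FollowsPolicy (B : GraphBandit K Ω) (P : Measure Ω) (π : ℕ → Fin K → Ω → ℝ) :
    Prop where
  adapted : ∀ t a, Measurable[B.hist t] (π t a)
  sampled : ∀ t a, P⟦B.action t ⁻¹' {a} | B.hist t ⊔ B.sigmaEnv⟧ =ᵐ[P] π t a

/-- Thompson Sampling without knowledge of the graphs: the policy `π_t = α_t`. -/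
def IsTSN (B : GraphBandit K Ω) (P : Measure Ω) : Prop :=
  B.FollowsPolicy P (B.posterior P)

/-- The Bayesian regret `𝔼[∑_{t < T} (Y_{t,A*} - Y_{t,A_t})]` of the first `T` rounds. -/
def bayesRegret (B : GraphBandit K Ω) (P : Measure Ω) (T : ℕ) : ℝ :=
  ∫ ω, ∑ t ∈ Finset.range T,
    ((B.reward t ω (B.optAction ω) : ℝ) - (B.reward t ω (B.action t ω) : ℝ)) ∂P

end GraphBandit

end

/-!
Let `α`, `q` be the posterior probability that an action is optimal and the probability that its
reward is observed in the current round, and let `δ` be the amount by which the conditional mean of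
this reward moves when the action is revealed to be optimal. Thompson sampling plays the action
with probability `α`, so the expected regret of the round is the sum of `𝔼[α δ]` over the actions,
and Cauchy–Schwarz bounds it by the square root of `∑ 𝔼[α / q] * ∑ 𝔼[q α δ²]`. The first factor is
`𝔼[Q_t]`, since `q` is the denominator in `graphQ`. The second is at most half the expected
decrease of the entropy of the posterior: the inequality `3 (r - 1)² ≤ (2 r + 4) (r log r + 1 - r)`
at the ratio `r` of the new to the old posterior probability, on the event that the reward is
observed, is Pinsker's inequality in a form that needs no regular conditional laws. The entropy
decreases telescope to at most `H(α₁)`, and a second Cauchy–Schwarz, over the rounds, finishes the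
proof.
-/

-- Pollard's route to Pinsker's inequality: the weight `2 * r + 4` has mean `6` when `r` is a
-- probability density, so that Cauchy–Schwarz recovers the optimal constant.
open InformationTheory in
theorem three_mul_sub_one_sq_le_mul_klFun {r : ℝ} (hr : 0 ≤ r) :
    3 * (r - 1) ^ 2 ≤ (2 * r + 4) * klFun r := by
  let h : ℝ → ℝ := fun x => (2 * x + 4) * klFun x - 3 * (x - 1) ^ 2
  let h' : ℝ → ℝ := fun x => (4 * x + 4) * Real.log x - 8 * (x - 1)
  have hasDeriv_h : ∀ x, 0 < x → HasDerivAt h (h' x) x := fun x hx => by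
    have := ((((hasDerivAt_id x).const_mul 2).add_const 4).mul (hasDerivAt_klFun hx.ne')).sub
      ((((hasDerivAt_id x).sub_const 1).pow 2).const_mul 3)
    refine this.congr_deriv ?_
    simp only [klFun_apply, id, h']
    ring
  have hasDeriv_h' : ∀ x, 0 < x → HasDerivAt h' (4 * (Real.log x + x⁻¹ - 1)) x := fun x hx => by
    have := ((((hasDerivAt_id x).const_mul 4).add_const 4).mul (Real.hasDerivAt_log hx.ne')).sub
      (((hasDerivAt_id x).sub_const 1).const_mul 8)
    refine this.congr_deriv ?_
    simp only [id]
    field_simp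
    ring
  have convex_h : ConvexOn ℝ (Set.Ici 0) h := by
    refine convexOn_of_hasDerivWithinAt2_nonneg (convex_Ici 0) (f' := h')
      (f'' := fun x => 4 * (Real.log x + x⁻¹ - 1))
      (by have := continuous_klFun; fun_prop) ?_ ?_ ?_ <;>
      simp only [interior_Ici, Set.mem_Ioi] <;> intro x hx
    · exact (hasDeriv_h x hx).hasDerivWithinAt
    · exact (hasDeriv_h' x hx).hasDerivWithinAt
    · linarith [Real.one_sub_inv_le_log_of_pos hx]
  have isMin_h : IsMinOn h (Set.Ici 0) 1 := by
    refine convex_h.isMinOn_of_rightDeriv_eq_zero (by simp) ?_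
    rw [(hasDeriv_h 1 one_pos).hasDerivWithinAt.derivWithin (uniqueDiffWithinAt_Ioi 1)]
    simp [h']
  have : h 1 ≤ h r := isMin_h hr
  simp only [h, klFun_one] at this
  linarith

open InformationTheory in
theorem four_mul_mul_sub_one_le_add_klFun {w d r u : ℝ} (hw : w ∈ Set.Icc (0 : ℝ) 1)
    (hr : 0 ≤ r) (hu : |u| ≤ 1 / 2) :
    4 * (w * d * (r - 1) * u) ≤ w * d ^ 2 * (2 * r + 4) / 3 + klFun r := by
  have pinsker := three_mul_sub_one_sq_le_mul_klFun hr
  have hs : 0 < 2 * r + 4 := by linarith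
  have hu2 : u ^ 2 ≤ 1 / 4 := by nlinarith [abs_le.1 hu]
  have amgm : 4 * (d * (r - 1) * u) ≤ d ^ 2 * (2 * r + 4) / 3 + klFun r := by
    refine le_of_mul_le_mul_left ?_ hs
    nlinarith [sq_nonneg (d * (2 * r + 4) - 6 * (r - 1) * u),
      mul_le_mul_of_nonneg_left hu2 (sq_nonneg (r - 1))]
  nlinarith [mul_le_mul_of_nonneg_left amgm hw.1,
    mul_le_mul_of_nonneg_right hw.2 (klFun_nonneg hr)]

section CondExp

variable {Ω : Type*} {m m0 : MeasurableSpace Ω} {P : Measure Ω} [IsFiniteMeasure P] {f g h : Ω → ℝ}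

theorem integral_mul_eq_of_condExp_ae_eq (hm : m ≤ m0) (hg : StronglyMeasurable[m] g)
    (hf : Integrable f P) (hgf : Integrable (fun ω => g ω * f ω) P) (hfh : P[f | m] =ᵐ[P] h) :
    ∫ ω, g ω * f ω ∂P = ∫ ω, g ω * h ω ∂P := by
  rw [← integral_condExp hm]
  exact integral_congr_ae ((condExp_mul_of_stronglyMeasurable_left hg hgf hf).trans
    (hfh.mono fun ω h => by rw [Pi.mul_apply, h]))

theorem lintegral_mul_ofReal_condExp (hm : m ≤ m0) (hf : Integrable f P) (hf0 : 0 ≤ᵐ[P] f)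
    {φ : Ω → ENNReal} (hφ : Measurable[m] φ) :
    ∫⁻ ω, φ ω * ENNReal.ofReal (P[f | m] ω) ∂P = ∫⁻ ω, φ ω * ENNReal.ofReal (f ω) ∂P := by
  have trim_eq : (P.withDensity fun ω => ENNReal.ofReal (P[f | m] ω)).trim hm
      = (P.withDensity fun ω => ENNReal.ofReal (f ω)).trim hm := by
    refine @Measure.ext _ m _ _ fun s hs => ?_
    rw [trim_measurableSet_eq hm hs, trim_measurableSet_eq hm hs, withDensity_apply _ (hm s hs),
      withDensity_apply _ (hm s hs),
      ← ofReal_integral_eq_lintegral_ofReal integrable_condExp.integrableOn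
        (ae_restrict_of_ae (condExp_nonneg hf0)),
      ← ofReal_integral_eq_lintegral_ofReal hf.integrableOn (ae_restrict_of_ae hf0),
      setIntegral_condExp hm hf hs]
  have lintegral_eq : ∀ g : Ω → ℝ, AEMeasurable g P → ∫⁻ ω, φ ω * ENNReal.ofReal (g ω) ∂P
      = ∫⁻ ω, φ ω ∂(P.withDensity fun ω => ENNReal.ofReal (g ω)).trim hm := fun g hg => by
    rw [lintegral_trim hm hφ,
      lintegral_withDensity_eq_lintegral_mul₀ hg.ennreal_ofReal (hφ.mono hm le_rfl).aemeasurable]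
    simp only [Pi.mul_apply, mul_comm]
  rw [lintegral_eq _ integrable_condExp.aemeasurable, lintegral_eq _ hf.aemeasurable, trim_eq]

theorem integrable_mul_of_integrable_mul_condExp (hm : m ≤ m0) (hf : Integrable f P)
    (hf0 : 0 ≤ᵐ[P] f) (hg : StronglyMeasurable[m] g)
    (h : Integrable (fun ω => g ω * P[f | m] ω) P) : Integrable (fun ω => g ω * f ω) P := by
  have enorm_mul_ae_eq : ∀ {x : Ω → ℝ}, 0 ≤ᵐ[P] x →
      (fun ω => ‖g ω * x ω‖ₑ) =ᵐ[P] fun ω => ‖g ω‖ₑ * ENNReal.ofReal (x ω) := fun hx => by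
    filter_upwards [hx] with ω hx
    rw [enorm_mul, Real.enorm_of_nonneg hx]
  refine ⟨(hg.mono hm).aestronglyMeasurable.mul hf.1, ?_⟩
  have hfin := h.2
  rw [HasFiniteIntegral, lintegral_congr_ae (enorm_mul_ae_eq (condExp_nonneg hf0)),
    lintegral_mul_ofReal_condExp hm hf hf0 hg.enorm] at hfin
  rwa [HasFiniteIntegral, lintegral_congr_ae (enorm_mul_ae_eq hf0)]

theorem ae_eq_zero_of_condExp_eq_zero (hm : m ≤ m0) (hf : Integrable f P) (hf0 : 0 ≤ᵐ[P] f) :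
    ∀ᵐ ω ∂P, P[f | m] ω = 0 → f ω = 0 := by
  let s : Set Ω := {ω | P[f | m] ω = 0}
  have hs : MeasurableSet[m] s := stronglyMeasurable_condExp.measurable (measurableSet_singleton 0)
  have hint : ∫ ω in s, f ω ∂P = 0 := by
    rw [← setIntegral_condExp hm hf hs]
    exact setIntegral_eq_zero_of_forall_eq_zero fun ω hω => hω
  exact (ae_restrict_iff' (hm s hs)).1
    ((integral_eq_zero_iff_of_nonneg_ae (ae_restrict_of_ae hf0) hf.integrableOn).1 hint)

end CondExp

section EntropyGap

open InformationTheory Real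

theorem mul_klFun_div {x y : ℝ} (h : x = 0 → y = 0) :
    x * klFun (y / x) = -(log x * y) - negMulLog y - y + x := by
  rcases eq_or_ne x 0 with rfl | hx
  · simp [h rfl]
  rcases eq_or_ne y 0 with rfl | hy
  · simp [klFun_zero]
  · rw [klFun_apply, log_div hy hx, negMulLog]
    field_simp
    ring

variable {Ω : Type*} {m m0 : MeasurableSpace Ω} {P : Measure Ω} {f : Ω → ℝ}

theorem stronglyMeasurable_log_condExp : StronglyMeasurable[m] fun ω => log (P[f | m] ω) :=
  (measurable_log.comp stronglyMeasurable_condExp.measurable).stronglyMeasurable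

variable [IsFiniteMeasure P]

theorem condExp_mul_klFun_div_ae_eq (hm : m ≤ m0) (hf : Integrable f P) (hf0 : 0 ≤ᵐ[P] f) :
    (fun ω => P[f | m] ω * klFun (f ω / P[f | m] ω)) =ᵐ[P] fun ω =>
      -(log (P[f | m] ω) * f ω) - negMulLog (f ω) - f ω + P[f | m] ω := by
  filter_upwards [ae_eq_zero_of_condExp_eq_zero hm hf hf0] with ω h using mul_klFun_div h

theorem integrable_log_condExp_mul (hm : m ≤ m0) (hf : Integrable f P) (hf0 : 0 ≤ᵐ[P] f)
    (hc : Integrable (fun ω => negMulLog (P[f | m] ω)) P) :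
    Integrable (fun ω => log (P[f | m] ω) * f ω) P := by
  refine integrable_mul_of_integrable_mul_condExp hm hf hf0 stronglyMeasurable_log_condExp
    (hc.neg.congr (ae_of_all _ fun ω => ?_))
  simp only [Pi.neg_apply, negMulLog]
  ring

theorem integrable_condExp_mul_klFun_div (hm : m ≤ m0) (hf : Integrable f P) (hf0 : 0 ≤ᵐ[P] f)
    (hent : Integrable (fun ω => negMulLog (f ω)) P)
    (hc : Integrable (fun ω => negMulLog (P[f | m] ω)) P) :
    Integrable (fun ω => P[f | m] ω * klFun (f ω / P[f | m] ω)) P :=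
  ((((integrable_log_condExp_mul hm hf hf0 hc).neg.sub hent).sub hf).add
    integrable_condExp).congr (condExp_mul_klFun_div_ae_eq hm hf hf0).symm

theorem integral_condExp_mul_klFun_div (hm : m ≤ m0) (hf : Integrable f P) (hf0 : 0 ≤ᵐ[P] f)
    (hent : Integrable (fun ω => negMulLog (f ω)) P)
    (hc : Integrable (fun ω => negMulLog (P[f | m] ω)) P) :
    ∫ ω, P[f | m] ω * klFun (f ω / P[f | m] ω) ∂P
      = ∫ ω, negMulLog (P[f | m] ω) ∂P - ∫ ω, negMulLog (f ω) ∂P := by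
  have hlog := integrable_log_condExp_mul hm hf hf0 hc
  have hcross : ∫ ω, log (P[f | m] ω) * f ω ∂P = -∫ ω, negMulLog (P[f | m] ω) ∂P := by
    rw [integral_mul_eq_of_condExp_ae_eq hm stronglyMeasurable_log_condExp hf hlog .rfl,
      ← integral_neg]
    refine integral_congr_ae (ae_of_all _ fun ω => ?_)
    simp only [negMulLog]
    ring
  rw [integral_congr_ae (condExp_mul_klFun_div_ae_eq hm hf hf0),
    integral_add (by exact (hlog.neg.sub hent).sub hf) integrable_condExp,
    integral_sub (by exact hlog.neg.sub hent) hf, integral_sub (by exact hlog.neg) hent,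
    integral_neg, hcross, integral_condExp hm]
  ring

end EntropyGap

section MeanShift

variable {Ω : Type*} {m m0 : MeasurableSpace Ω} {P : Measure Ω} {X Y : Ω → ℝ}

/-- When `X` is the indicator of an event `E`, this is the amount `𝔼[Y | E, m] - 𝔼[Y | m]` by which
the conditional mean of `Y` moves when `E` is revealed on top of `m`. It is `-𝔼[Y | m]` where
`E` has conditional probability `0`. -/
noncomputable def meanShift (P : Measure Ω) (m : MeasurableSpace Ω) (X Y : Ω → ℝ) (ω : Ω) : ℝ :=
  P[fun ω => X ω * Y ω | m] ω / P[X | m] ω - P[Y | m] ω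

theorem stronglyMeasurable_meanShift : StronglyMeasurable[m] (meanShift P m X Y) :=
  (stronglyMeasurable_condExp.measurable.div
    stronglyMeasurable_condExp.measurable).stronglyMeasurable.sub stronglyMeasurable_condExp

variable [IsFiniteMeasure P]

theorem condExp_mem_Icc (hm : m ≤ m0) {f : Ω → ℝ} {a b : ℝ} (hf : Integrable f P)
    (hfab : ∀ᵐ ω ∂P, f ω ∈ Set.Icc a b) : ∀ᵐ ω ∂P, P[f | m] ω ∈ Set.Icc a b :=
  Convex.condExp_mem hm hf isClosed_Icc (convex_Icc a b) hfab

theorem memLp_top_condExp (hm : m ≤ m0) {f : Ω → ℝ} {a b : ℝ} (hf : Integrable f P)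
    (hfab : ∀ᵐ ω ∂P, f ω ∈ Set.Icc a b) : MemLp (P[f | m]) ⊤ P :=
  memLp_of_bounded (condExp_mem_Icc hm hf hfab)
    integrable_condExp.aestronglyMeasurable ⊤

theorem condExp_mul_mem_Icc (hX : Integrable X P) (hX0 : 0 ≤ᵐ[P] X)
    (hY : AEStronglyMeasurable Y P) (hY01 : ∀ᵐ ω ∂P, Y ω ∈ Set.Icc (0 : ℝ) 1) :
    ∀ᵐ ω ∂P, P[fun ω => X ω * Y ω | m] ω ∈ Set.Icc 0 (P[X | m] ω) := by
  have hXY : Integrable (fun ω => X ω * Y ω) P :=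
    hX.mul_of_top_left (memLp_of_bounded hY01 hY ⊤)
  have nonneg : 0 ≤ᵐ[P] P[fun ω => X ω * Y ω | m] := condExp_nonneg <| by
    filter_upwards [hX0, hY01] with ω hX hY using mul_nonneg hX hY.1
  have le : P[fun ω => X ω * Y ω | m] ≤ᵐ[P] P[X | m] := condExp_mono hXY hX <| by
    filter_upwards [hX0, hY01] with ω hX hY using mul_le_of_le_one_right hX hY.2
  filter_upwards [nonneg, le] with ω h0 h1 using ⟨h0, h1⟩

theorem abs_meanShift_le_one (hm : m ≤ m0) (hX : Integrable X P) (hX0 : 0 ≤ᵐ[P] X)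
    (hY : AEStronglyMeasurable Y P) (hY01 : ∀ᵐ ω ∂P, Y ω ∈ Set.Icc (0 : ℝ) 1) :
    ∀ᵐ ω ∂P, |meanShift P m X Y ω| ≤ 1 := by
  filter_upwards [condExp_mul_mem_Icc hX hX0 hY hY01,
    condExp_mem_Icc hm ((memLp_of_bounded hY01 hY ⊤).integrable le_top) hY01] with ω hXY hY
  have hratio : P[fun ω => X ω * Y ω | m] ω / P[X | m] ω ∈ Set.Icc (0 : ℝ) 1 :=
    ⟨div_nonneg hXY.1 (hXY.1.trans hXY.2), div_le_one_of_le₀ hXY.2 (hXY.1.trans hXY.2)⟩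
  exact abs_sub_le_of_nonneg_of_le hratio.1 hratio.2 hY.1 hY.2

theorem memLp_top_meanShift (hm : m ≤ m0) (hX : Integrable X P) (hX0 : 0 ≤ᵐ[P] X)
    (hY : AEStronglyMeasurable Y P) (hY01 : ∀ᵐ ω ∂P, Y ω ∈ Set.Icc (0 : ℝ) 1) :
    MemLp (meanShift P m X Y) ⊤ P :=
  memLp_top_of_bound (stronglyMeasurable_meanShift.mono hm).aestronglyMeasurable 1
    (abs_meanShift_le_one hm hX hX0 hY hY01)

theorem condExp_sub_condExp_mul_sub_const (hm : m ≤ m0) (hX : Integrable X P) (hX0 : 0 ≤ᵐ[P] X)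
    (hY : AEStronglyMeasurable Y P) (hY01 : ∀ᵐ ω ∂P, Y ω ∈ Set.Icc (0 : ℝ) 1) (c : ℝ) :
    P[fun ω => (X ω - P[X | m] ω) * (Y ω - c) | m]
      =ᵐ[P] fun ω => P[X | m] ω * meanShift P m X Y ω := by
  have hYtop := memLp_of_bounded hY01 hY ⊤
  have hXY : Integrable (fun ω => X ω * Y ω) P := hX.mul_of_top_left hYtop
  have hαY : Integrable (P[X | m] * Y) P := integrable_condExp.mul_of_top_left hYtop
  have expand : (fun ω => (X ω - P[X | m] ω) * (Y ω - c))
      = (fun ω => X ω * Y ω) - P[X | m] * Y - c • (X - P[X | m]) := by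
    funext ω
    simp only [Pi.sub_apply, Pi.mul_apply, Pi.smul_apply, smul_eq_mul]
    ring
  have hα : P[P[X | m] | m] = P[X | m] :=
    condExp_of_stronglyMeasurable hm stronglyMeasurable_condExp integrable_condExp
  rw [expand]
  filter_upwards [condExp_sub (hXY.sub hαY) ((hX.sub integrable_condExp).smul c) m,
    condExp_sub hXY hαY m, condExp_smul c (X - P[X | m]) (μ := P) m,
    condExp_sub hX (integrable_condExp (f := X) (m := m)) m,
    condExp_mul_of_stronglyMeasurable_left stronglyMeasurable_condExp hαY
      (hYtop.integrable le_top), condExp_mul_mem_Icc (m := m) hX hX0 hY hY01]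
    with ω h h1 h2 h3 h4 hXYα
  simp only [Pi.sub_apply, Pi.smul_apply, Pi.mul_apply, smul_eq_mul, hα] at h h1 h2 h3 h4
  have hcancel := mul_div_cancel_of_imp' fun hα0 : P[X | m] ω = 0 =>
    le_antisymm (hXYα.2.trans_eq hα0) hXYα.1
  rw [h, h1, h2, h3, h4, meanShift]
  linear_combination -hcancel

end MeanShift

section InformationGain

open Real InformationTheory

variable {Ω : Type*} {m m' n m0 : MeasurableSpace Ω} {P : Measure Ω} [IsFiniteMeasure P]
  {W X Y U φ δ α q : Ω → ℝ}

theorem four_mul_mul_sub_le_add_mul_klFun_div {w d u x y : ℝ} (hw : w ∈ Set.Icc (0 : ℝ) 1)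
    (hu : |u| ≤ 1 / 2) (hx : 0 ≤ x) (hy : 0 ≤ y) (hxy : x = 0 → y = 0) :
    4 * (w * (d * u) * (y - x)) ≤
      2 / 3 * (w * (d * d) * (y - x)) + 2 * (w * (d * d) * x) + x * klFun (y / x) := by
  have hyr : x * (y / x) = y := mul_div_cancel_of_imp' hxy
  have h := mul_le_mul_of_nonneg_left
    (four_mul_mul_sub_one_le_add_klFun (d := d) hw (div_nonneg hy hx) hu) hx
  linear_combination h + (2 / 3 * (w * d ^ 2) - 4 * (w * d * u)) * hyr

theorem integrable_negMulLog (hX : AEStronglyMeasurable X P)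
    (hX01 : ∀ᵐ ω ∂P, X ω ∈ Set.Icc (0 : ℝ) 1) : Integrable (fun ω => negMulLog (X ω)) P := by
  refine .of_bound (continuous_negMulLog.comp_aestronglyMeasurable hX) 1 ?_
  filter_upwards [hX01] with ω h
  rw [norm_of_nonneg (negMulLog_nonneg h.1 h.2)]
  linarith [negMulLog_le_one_sub_self h.1, h.1]

theorem integrable_negMulLog_condExp (hm : m ≤ m0) (hX : Integrable X P)
    (hX01 : ∀ᵐ ω ∂P, X ω ∈ Set.Icc (0 : ℝ) 1) : Integrable (fun ω => negMulLog (P[X | m] ω)) P :=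
  integrable_negMulLog integrable_condExp.aestronglyMeasurable (condExp_mem_Icc hm hX hX01)

theorem condExp_condExp_mul_klFun_div_ae_eq (hmm' : m ≤ m') (hm' : m' ≤ m0) :
    (fun ω => P[P[X | m'] | m] ω * klFun (P[X | m'] ω / P[P[X | m'] | m] ω))
      =ᵐ[P] fun ω => P[X | m] ω * klFun (P[X | m'] ω / P[X | m] ω) := by
  filter_upwards [condExp_condExp_of_le (f := X) (μ := P) hmm' hm'] with ω h using by rw [h]

theorem integrable_condExp_mul_klFun_condExp_div (hmm' : m ≤ m') (hm' : m' ≤ m0)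
    (hX : Integrable X P) (hX01 : ∀ᵐ ω ∂P, X ω ∈ Set.Icc (0 : ℝ) 1) :
    Integrable (fun ω => P[X | m] ω * klFun (P[X | m'] ω / P[X | m] ω)) P := by
  have hβ01 := condExp_mem_Icc hm' hX hX01
  exact (integrable_condExp_mul_klFun_div (hmm'.trans hm') integrable_condExp
    (hβ01.mono fun ω h => h.1) (integrable_negMulLog_condExp hm' hX hX01)
    (integrable_negMulLog_condExp (hmm'.trans hm') integrable_condExp hβ01)).congr
    (condExp_condExp_mul_klFun_div_ae_eq hmm' hm')

theorem integral_condExp_mul_klFun_condExp_div (hmm' : m ≤ m') (hm' : m' ≤ m0)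
    (hX : Integrable X P) (hX01 : ∀ᵐ ω ∂P, X ω ∈ Set.Icc (0 : ℝ) 1) :
    ∫ ω, P[X | m] ω * klFun (P[X | m'] ω / P[X | m] ω) ∂P
      = ∫ ω, negMulLog (P[X | m] ω) ∂P - ∫ ω, negMulLog (P[X | m'] ω) ∂P := by
  have hβ01 := condExp_mem_Icc hm' hX hX01
  have htower : (fun ω => negMulLog (P[P[X | m'] | m] ω)) =ᵐ[P] fun ω => negMulLog (P[X | m] ω) :=
    (condExp_condExp_of_le hmm' hm').fun_comp negMulLog
  rw [← integral_congr_ae (condExp_condExp_mul_klFun_div_ae_eq hmm' hm'),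
    integral_condExp_mul_klFun_div (hmm'.trans hm') integrable_condExp
      (hβ01.mono fun ω h => h.1) (integrable_negMulLog_condExp hm' hX hX01)
      (integrable_negMulLog_condExp (hmm'.trans hm') integrable_condExp hβ01),
    integral_congr_ae htower]

theorem four_mul_integral_le_add_integral_negMulLog_sub
    (hmm' : m ≤ m') (hm' : m' ≤ m0) (hW : AEStronglyMeasurable W P)
    (hW01 : ∀ᵐ ω ∂P, W ω ∈ Set.Icc (0 : ℝ) 1) (hX : Integrable X P)
    (hX01 : ∀ᵐ ω ∂P, X ω ∈ Set.Icc (0 : ℝ) 1) (hU : AEStronglyMeasurable U P)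
    (hU12 : ∀ᵐ ω ∂P, |U ω| ≤ 1 / 2) (hδ : MemLp δ ⊤ P) :
    4 * ∫ ω, W ω * (δ ω * U ω) * (P[X | m'] ω - P[X | m] ω) ∂P ≤
      2 / 3 * ∫ ω, W ω * (δ ω * δ ω) * (P[X | m'] ω - P[X | m] ω) ∂P
        + 2 * ∫ ω, W ω * (δ ω * δ ω) * P[X | m] ω ∂P
        + (∫ ω, negMulLog (P[X | m] ω) ∂P - ∫ ω, negMulLog (P[X | m'] ω) ∂P) := by
  have hm := hmm'.trans hm'
  have hα := memLp_top_condExp hm hX hX01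
  have hβ := memLp_top_condExp hm' hX hX01
  have hWtop : MemLp W ⊤ P := memLp_of_bounded hW01 hW ⊤
  have hUtop : MemLp U ⊤ P := memLp_top_of_bound hU _ hU12
  have hint : ∀ {φ Z : Ω → ℝ}, MemLp φ ⊤ P → MemLp Z ⊤ P →
      Integrable (fun ω => W ω * (δ ω * φ ω) * Z ω) P :=
    fun hφ hZ =>
      (hZ.integrable le_top).mul_of_top_right ((hφ.mul' (r := ⊤) hδ).mul' (r := ⊤) hWtop)
  have hkl := integrable_condExp_mul_klFun_condExp_div hmm' hm' hX hX01
  have pointwise : ∀ᵐ ω ∂P, 4 * (W ω * (δ ω * U ω) * (P[X | m'] ω - P[X | m] ω)) ≤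
      2 / 3 * (W ω * (δ ω * δ ω) * (P[X | m'] ω - P[X | m] ω))
        + 2 * (W ω * (δ ω * δ ω) * P[X | m] ω) + P[X | m] ω * klFun (P[X | m'] ω / P[X | m] ω) := by
    have hβ0 : 0 ≤ᵐ[P] P[X | m'] := (condExp_mem_Icc hm' hX hX01).mono fun ω h => h.1
    filter_upwards [hW01, hU12, condExp_mem_Icc hm hX hX01, hβ0,
      condExp_condExp_of_le (f := X) (μ := P) hmm' hm',
      ae_eq_zero_of_condExp_eq_zero hm integrable_condExp hβ0] with ω hw hu hα hβ htower habs
    exact four_mul_mul_sub_le_add_mul_klFun_div hw hu hα.1 hβ (htower ▸ habs)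
  have hgap := (hint hδ (hβ.sub hα)).const_mul (2 / 3)
  have hsq := (hint hδ hα).const_mul 2
  refine (integral_const_mul 4 _).symm.trans_le ((integral_mono_ae
    ((hint hUtop (hβ.sub hα)).const_mul 4) ((hgap.add hsq).add hkl) pointwise).trans_eq ?_)
  rw [integral_add' (hgap.add hsq) hkl, integral_add' hgap hsq, integral_const_mul,
    integral_const_mul,
    integral_condExp_mul_klFun_condExp_div hmm' hm' hX hX01]
  rfl

theorem integral_mul_condExp_sub (hn : n ≤ m0) (hm' : m' ≤ m0)
    (hW : MemLp W ⊤ P) (hWq : P[W | n] =ᵐ[P] q) (hX : StronglyMeasurable[n] X) (hXtop : MemLp X ⊤ P)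
    (hα : StronglyMeasurable[n] α) (hαtop : MemLp α ⊤ P)
    (hφ : StronglyMeasurable[n] φ) (hφtop : MemLp φ ⊤ P)
    (hWφ : StronglyMeasurable[m'] fun ω => W ω * φ ω) :
    ∫ ω, W ω * φ ω * (P[X | m'] ω - α ω) ∂P = ∫ ω, φ ω * (X ω - α ω) * q ω ∂P := by
  have hXint := hXtop.integrable le_top
  have hWφtop : MemLp (fun ω => W ω * φ ω) ⊤ P := hφtop.mul' hW
  have hφXα : MemLp (fun ω => φ ω * (X ω - α ω)) ⊤ P := (hXtop.sub hαtop).mul' hφtop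
  have hint : ∀ {Z : Ω → ℝ}, Integrable Z P → Integrable (fun ω => W ω * φ ω * Z ω) P :=
    fun hZ => hZ.mul_of_top_right hWφtop
  have hαint := hαtop.integrable le_top
  calc ∫ ω, W ω * φ ω * (P[X | m'] ω - α ω) ∂P
      = ∫ ω, W ω * φ ω * P[X | m'] ω ∂P - ∫ ω, W ω * φ ω * α ω ∂P := by
        rw [← integral_sub (hint integrable_condExp) (hint hαint)]
        simp only [mul_sub]
    _ = ∫ ω, W ω * φ ω * X ω ∂P - ∫ ω, W ω * φ ω * α ω ∂P := by
        rw [integral_mul_eq_of_condExp_ae_eq hm' hWφ hXint (hint hXint) .rfl]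
    _ = ∫ ω, φ ω * (X ω - α ω) * W ω ∂P := by
        rw [← integral_sub (hint hXint) (hint hαint)]
        congr! 2 with ω
        ring
    _ = ∫ ω, φ ω * (X ω - α ω) * q ω ∂P :=
        integral_mul_eq_of_condExp_ae_eq hn (hφ.mul (hX.sub hα))
          (hW.integrable le_top) ((hW.mul' hφXα).integrable le_top) hWq

theorem integral_mul_sub_const_mul_condExp_sub (hmm' : m ≤ m') (hm' : m' ≤ m0) (hmn : m ≤ n)
    (hn : n ≤ m0) (hW : StronglyMeasurable[m'] W)
    (hWY : StronglyMeasurable[m'] fun ω => W ω * Y ω) (hWtop : MemLp W ⊤ P) (hWq : P[W | n] =ᵐ[P] q)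
    (hq : StronglyMeasurable[m] q) (hqtop : MemLp q ⊤ P) (hX : StronglyMeasurable[n] X)
    (hX01 : ∀ᵐ ω ∂P, X ω ∈ Set.Icc (0 : ℝ) 1) (hY : StronglyMeasurable[n] Y)
    (hY01 : ∀ᵐ ω ∂P, Y ω ∈ Set.Icc (0 : ℝ) 1) (hφ : StronglyMeasurable[m] φ)
    (hφtop : MemLp φ ⊤ P) (c : ℝ) :
    ∫ ω, W ω * (φ ω * (Y ω - c)) * (P[X | m'] ω - P[X | m] ω) ∂P
      = ∫ ω, q ω * φ ω * (P[X | m] ω * meanShift P m X Y ω) ∂P := by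
  have hm := hmn.trans hn
  have hY0 := (hY.mono hn).aestronglyMeasurable (μ := P)
  have hXtop : MemLp X ⊤ P := memLp_of_bounded hX01 (hX.mono hn).aestronglyMeasurable ⊤
  have hXint := hXtop.integrable le_top
  have hα := memLp_top_condExp hm hXint hX01
  have hYtop : MemLp (fun ω => Y ω - c) ⊤ P := (memLp_of_bounded hY01 hY0 ⊤).sub (memLp_const c)
  have hcov : MemLp (fun ω => (X ω - P[X | m] ω) * (Y ω - c)) ⊤ P := hYtop.mul' (hXtop.sub hα)
  -- `Y` itself need not be `m'`-measurable: only its observed part `W * Y` is.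
  have hWφY : StronglyMeasurable[m'] fun ω => W ω * (φ ω * (Y ω - c)) := by
    have h := (hφ.mono hmm').mul (hWY.sub (hW.mul_const c))
    convert h using 1
    funext ω
    simp only [Pi.mul_apply, Pi.sub_apply]
    ring
  calc ∫ ω, W ω * (φ ω * (Y ω - c)) * (P[X | m'] ω - P[X | m] ω) ∂P
      = ∫ ω, φ ω * (Y ω - c) * (X ω - P[X | m] ω) * q ω ∂P :=
        integral_mul_condExp_sub (φ := fun ω => φ ω * (Y ω - c)) hn hm' hWtop hWq hX hXtop
          (stronglyMeasurable_condExp.mono hmn) hα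
          ((hφ.mono hmn).mul (hY.sub stronglyMeasurable_const)) (hYtop.mul' hφtop) hWφY
    _ = ∫ ω, q ω * φ ω * ((X ω - P[X | m] ω) * (Y ω - c)) ∂P := by
        congr! 2 with ω
        ring
    _ = ∫ ω, q ω * φ ω * (P[X | m] ω * meanShift P m X Y ω) ∂P :=
        integral_mul_eq_of_condExp_ae_eq hm (hq.mul hφ) (hcov.integrable le_top)
          ((hcov.integrable le_top).mul_of_top_right (hφtop.mul' (r := ⊤) hqtop))
          (condExp_sub_condExp_mul_sub_const hm hXint (hX01.mono fun ω h => h.1) hY0 hY01 c)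

theorem integral_mul_condExp_sub_condExp_eq_zero (hm' : m' ≤ m0) (hmn : m ≤ n) (hn : n ≤ m0)
    (hW : MemLp W ⊤ P) (hWq : P[W | n] =ᵐ[P] q) (hq : StronglyMeasurable[m] q) (hqtop : MemLp q ⊤ P)
    (hX : StronglyMeasurable[n] X) (hX01 : ∀ᵐ ω ∂P, X ω ∈ Set.Icc (0 : ℝ) 1)
    (hφ : StronglyMeasurable[m] φ) (hφtop : MemLp φ ⊤ P)
    (hWφ : StronglyMeasurable[m'] fun ω => W ω * φ ω) :
    ∫ ω, W ω * φ ω * (P[X | m'] ω - P[X | m] ω) ∂P = 0 := by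
  have hm := hmn.trans hn
  have hXtop : MemLp X ⊤ P := memLp_of_bounded hX01 (hX.mono hn).aestronglyMeasurable ⊤
  have hXint := hXtop.integrable le_top
  have hqφ : MemLp (fun ω => q ω * φ ω) ⊤ P := hφtop.mul' hqtop
  calc ∫ ω, W ω * φ ω * (P[X | m'] ω - P[X | m] ω) ∂P
      = ∫ ω, φ ω * (X ω - P[X | m] ω) * q ω ∂P :=
        integral_mul_condExp_sub hn hm' hW hWq hX hXtop (stronglyMeasurable_condExp.mono hmn)
          (memLp_top_condExp hm hXint hX01) (hφ.mono hmn) hφtop hWφ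
    _ = ∫ ω, q ω * φ ω * X ω ∂P - ∫ ω, q ω * φ ω * P[X | m] ω ∂P := by
        rw [← integral_sub (by exact hXint.mul_of_top_right hqφ)
          (by exact integrable_condExp.mul_of_top_right hqφ)]
        congr! 2 with ω
        ring
    _ = 0 := sub_eq_zero.2 (integral_mul_eq_of_condExp_ae_eq hm (hq.mul hφ) hXint
        (hXint.mul_of_top_right hqφ) .rfl)

theorem two_mul_integral_sq_meanShift_le (hmm' : m ≤ m') (hm' : m' ≤ m0) (hmn : m ≤ n)
    (hn : n ≤ m0) (hW : StronglyMeasurable[m'] W)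
    (hWY : StronglyMeasurable[m'] fun ω => W ω * Y ω)
    (hW01 : ∀ᵐ ω ∂P, W ω ∈ Set.Icc (0 : ℝ) 1) (hWq : P[W | n] =ᵐ[P] q)
    (hq : StronglyMeasurable[m] q) (hX : StronglyMeasurable[n] X)
    (hX01 : ∀ᵐ ω ∂P, X ω ∈ Set.Icc (0 : ℝ) 1) (hY : StronglyMeasurable[n] Y)
    (hY01 : ∀ᵐ ω ∂P, Y ω ∈ Set.Icc (0 : ℝ) 1) :
    2 * ∫ ω, q ω * P[X | m] ω * meanShift P m X Y ω ^ 2 ∂P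
      ≤ ∫ ω, negMulLog (P[X | m] ω) ∂P - ∫ ω, negMulLog (P[X | m'] ω) ∂P := by
  have hm := hmn.trans hn
  set δ := meanShift P m X Y with hδdef
  have hY0 := (hY.mono hn).aestronglyMeasurable (μ := P)
  have hXtop : MemLp X ⊤ P := memLp_of_bounded hX01 (hX.mono hn).aestronglyMeasurable ⊤
  have hXint := hXtop.integrable le_top
  have hα := memLp_top_condExp hm hXint hX01
  have hW0 := (hW.mono hm').aestronglyMeasurable (μ := P)
  have hWtop : MemLp W ⊤ P := memLp_of_bounded hW01 hW0 ⊤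
  have hWint := hWtop.integrable le_top
  have hqtop : MemLp q ⊤ P := (memLp_congr_ae hWq).1 (memLp_top_condExp hn hWint hW01)
  have hδ : StronglyMeasurable[m] δ := stronglyMeasurable_meanShift
  have hδtop : MemLp δ ⊤ P := memLp_top_meanShift hm hXint (hX01.mono fun ω h => h.1) hY0 hY01
  have hδδtop : MemLp (fun ω => δ ω * δ ω) ⊤ P := hδtop.mul' hδtop
  have hδδα : MemLp (fun ω => δ ω * δ ω * P[X | m] ω) ⊤ P := hα.mul' hδδtop
  -- Centring `Y` at `1 / 2` leaves its conditional covariance with `X` unchanged and gives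
  -- `|Y - 1 / 2| ≤ 1 / 2`, whence the factor `2` on the left-hand side.
  have linear := integral_mul_sub_const_mul_condExp_sub hmm' hm' hmn hn hW hWY hWtop hWq hq hqtop
    hX hX01 hY hY01 hδ hδtop (1 / 2)
  have quadratic_shift : ∫ ω, W ω * (δ ω * δ ω) * (P[X | m'] ω - P[X | m] ω) ∂P = 0 :=
    integral_mul_condExp_sub_condExp_eq_zero hm' hmn hn hWtop hWq hq hqtop hX hX01 (hδ.mul hδ)
      hδδtop (hW.mul ((hδ.mul hδ).mono hmm'))
  have quadratic : ∫ ω, W ω * (δ ω * δ ω) * P[X | m] ω ∂P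
      = ∫ ω, q ω * P[X | m] ω * δ ω ^ 2 ∂P := by
    have h := integral_mul_eq_of_condExp_ae_eq hn
      (((hδ.mul hδ).mul stronglyMeasurable_condExp).mono hmn) hWint
      (hWint.mul_of_top_right hδδα) hWq
    convert h using 3 <;> simp only [Pi.mul_apply] <;> ring
  have hU12 : ∀ᵐ ω ∂P, |Y ω - 1 / 2| ≤ 1 / 2 :=
    hY01.mono fun ω h => abs_le.2 ⟨by linarith [h.1], by linarith [h.2]⟩
  have pinsker := four_mul_integral_le_add_integral_negMulLog_sub hmm' hm' hW0 hW01 hXint hX01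
    (hY0.sub aestronglyMeasurable_const) hU12 hδtop
  have hS : ∫ ω, q ω * δ ω * (P[X | m] ω * δ ω) ∂P = ∫ ω, q ω * P[X | m] ω * δ ω ^ 2 ∂P := by
    congr! 2 with ω
    ring
  simp only [Pi.sub_apply] at pinsker
  rw [linear, quadratic_shift, quadratic, ← hδdef, hS] at pinsker
  linarith

end InformationGain

section SqrtIntegral

variable {Ω : Type*} {m0 : MeasurableSpace Ω} {P : Measure Ω}

theorem integral_sqrt_mul_sqrt_le {f g : Ω → ℝ} (hf : Integrable f P) (hf0 : 0 ≤ᵐ[P] f)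
    (hg : Integrable g P) (hg0 : 0 ≤ᵐ[P] g) :
    ∫ ω, √(f ω) * √(g ω) ∂P ≤ √(∫ ω, f ω ∂P) * √(∫ ω, g ω ∂P) := by
  have sq_sqrt_ae_eq : ∀ {u : Ω → ℝ}, 0 ≤ᵐ[P] u → (fun ω => √(u ω) ^ 2) =ᵐ[P] u :=
    fun hu => hu.mono fun ω h => Real.sq_sqrt h
  have memLp_sqrt : ∀ {u : Ω → ℝ}, Integrable u P → 0 ≤ᵐ[P] u →
      MemLp (fun ω => √(u ω)) (ENNReal.ofReal 2) P := fun hu hu0 => by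
    rw [ENNReal.ofReal_ofNat, memLp_two_iff_integrable_sq
      (Real.continuous_sqrt.comp_aestronglyMeasurable hu.1)]
    exact hu.congr (sq_sqrt_ae_eq hu0).symm
  have holder := integral_mul_le_Lp_mul_Lq_of_nonneg Real.HolderConjugate.two_two
    (ae_of_all P fun ω => Real.sqrt_nonneg (f ω)) (ae_of_all P fun ω => Real.sqrt_nonneg (g ω))
    (memLp_sqrt hf hf0) (memLp_sqrt hg hg0)
  simpa only [Real.rpow_ofNat, ← Real.sqrt_eq_rpow, integral_congr_ae (sq_sqrt_ae_eq hf0),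
    integral_congr_ae (sq_sqrt_ae_eq hg0)] using holder

variable [IsFiniteMeasure P] {α q δ : Ω → ℝ}

theorem integrable_div_of_le (hα : AEStronglyMeasurable α P) (hq : AEStronglyMeasurable q P)
    (hα0 : 0 ≤ᵐ[P] α) (hαq : α ≤ᵐ[P] q) : Integrable (fun ω => α ω / q ω) P := by
  refine .of_bound (hα.aemeasurable.div hq.aemeasurable).aestronglyMeasurable 1 ?_
  filter_upwards [hα0, hαq] with ω h0 h
  rw [Real.norm_of_nonneg (div_nonneg h0 (h0.trans h))]
  exact div_le_one_of_le₀ h (h0.trans h)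

theorem integral_mul_le_sqrt_integral_div_mul_sqrt (hα : MemLp α ⊤ P) (hq : MemLp q ⊤ P)
    (hδ : MemLp δ ⊤ P) (hα0 : 0 ≤ᵐ[P] α) (hαq : α ≤ᵐ[P] q) :
    ∫ ω, α ω * δ ω ∂P ≤ √(∫ ω, α ω / q ω ∂P) * √(∫ ω, q ω * α ω * δ ω ^ 2 ∂P) := by
  have hδδ : MemLp (fun ω => δ ω ^ 2) ⊤ P := by
    simpa only [sq] using hδ.mul' (r := ⊤) hδ
  have hsq : Integrable (fun ω => q ω * α ω * δ ω ^ 2) P :=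
    (hδδ.mul' (r := ⊤) (hα.mul' (r := ⊤) hq)).integrable le_top
  have hfactor : (fun ω => √(α ω / q ω) * √(q ω * α ω * δ ω ^ 2)) =ᵐ[P]
      fun ω => |α ω * δ ω| := by
    filter_upwards [hα0, hαq] with ω h0 h
    have hcancel : q ω = 0 → α ω = 0 := fun hq0 => le_antisymm (h.trans_eq hq0) h0
    rw [← Real.sqrt_mul (div_nonneg h0 (h0.trans h)), ← Real.sqrt_sq_eq_abs]
    congr 1
    linear_combination α ω * δ ω ^ 2 * div_mul_cancel_of_imp hcancel
  calc ∫ ω, α ω * δ ω ∂P ≤ ∫ ω, |α ω * δ ω| ∂P :=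
        (le_abs_self _).trans abs_integral_le_integral_abs
    _ = ∫ ω, √(α ω / q ω) * √(q ω * α ω * δ ω ^ 2) ∂P := (integral_congr_ae hfactor).symm
    _ ≤ √(∫ ω, α ω / q ω ∂P) * √(∫ ω, q ω * α ω * δ ω ^ 2 ∂P) := by
        refine integral_sqrt_mul_sqrt_le (integrable_div_of_le hα.1 hq.1 hα0 hαq) ?_ hsq ?_
        · filter_upwards [hα0, hαq] with ω h0 h using div_nonneg h0 (h0.trans h)
        · filter_upwards [hα0, hαq] with ω h0 h
          exact mul_nonneg (mul_nonneg (h0.trans h) h0) (sq_nonneg _)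

end SqrtIntegral

section Choice

variable {Ω ι : Type*}

/-- The indicator function of the event that the random choice `f` takes the value `a`. -/
noncomputable abbrev choiceInd (f : Ω → ι) (a : ι) : Ω → ℝ :=
  (f ⁻¹' {a}).indicator fun _ => 1

theorem choiceInd_mem_Icc (f : Ω → ι) (a : ι) (ω : Ω) : choiceInd f a ω ∈ Set.Icc (0 : ℝ) 1 := by
  by_cases h : ω ∈ f ⁻¹' {a} <;> simp [choiceInd, h]

theorem sum_choiceInd_mul [Fintype ι] (f : Ω → ι) (y : ι → ℝ) (ω : Ω) :
    ∑ a, choiceInd f a ω * y a = y (f ω) := by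
  rw [Finset.sum_eq_single (f ω)] <;> simp +contextual [choiceInd, eq_comm]

theorem measurable_choiceInd [MeasurableSpace ι] [MeasurableSingletonClass ι]
    {_ : MeasurableSpace Ω} {f : Ω → ι} (hf : Measurable f) (a : ι) : Measurable (choiceInd f a) :=
  measurable_const.indicator (hf (measurableSet_singleton a))

theorem integrable_choiceInd [MeasurableSpace ι] [MeasurableSingletonClass ι]
    {_ : MeasurableSpace Ω} {P : Measure Ω} [IsFiniteMeasure P] {f : Ω → ι} (hf : Measurable f)
    (a : ι) : Integrable (choiceInd f a) P :=
  (integrable_const 1).indicator (hf (measurableSet_singleton a))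

theorem shannonEntropy_eq_sum_negMulLog {K : ℕ} (p : Fin K → ℝ) :
    shannonEntropy p = ∑ a, Real.negMulLog (p a) := by
  simp only [shannonEntropy, Real.negMulLog, neg_mul, Finset.sum_neg_distrib]

theorem graphQ_nonneg {K : ℕ} {G : Digraph (Fin K)} {p : Fin K → ℝ} (hp : ∀ a, 0 ≤ p a) :
    0 ≤ graphQ G p :=
  Finset.sum_nonneg fun a _ => div_nonneg (hp a) (Finset.sum_nonneg fun j _ => hp j)

end Choice

namespace GraphBandit

variable {K : ℕ} {Ω : Type*}

open Classical in
/-- The indicator function of the event that the reward of `a` is observed in round `t`. -/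
noncomputable def obsInd (B : GraphBandit K Ω) (t : ℕ) (a : Fin K) (ω : Ω) : ℝ :=
  if (B.graph t).Adj (B.action t ω) a then 1 else 0

open Classical in
/-- The probability under the policy `π` that the reward of `a` is observed in round `t`: the
denominator in `graphQ`. -/
noncomputable def obsProb (B : GraphBandit K Ω) (π : ℕ → Fin K → Ω → ℝ) (t : ℕ) (a : Fin K)
    (ω : Ω) : ℝ :=
  ∑ j ∈ Finset.univ.filter (fun j => (B.graph t).Adj j a), π t j ω

section Measurability

variable (B : GraphBandit K Ω) (t : ℕ) (a : Fin K)

theorem hist_le_hist_succ : B.hist t ≤ B.hist (t + 1) :=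
  iSup_le fun s => le_iSup (fun s : Fin (t + 1) =>
    MeasurableSpace.comap (B.observation s) inferInstance) s.castSucc

theorem measurable_observation_hist_succ : Measurable[B.hist (t + 1)] (B.observation t) :=
  measurable_iff_comap_le.2 (le_iSup (fun s : Fin (t + 1) =>
    MeasurableSpace.comap (B.observation s) inferInstance) (Fin.last t))

theorem measurable_reward_sigmaEnv : Measurable[B.sigmaEnv] (B.reward t) :=
  measurable_iff_comap_le.2
    ((le_iSup (fun s => MeasurableSpace.comap (B.reward s) inferInstance) t).trans le_sup_right)

theorem measurable_coe_reward_sigmaEnv : Measurable[B.sigmaEnv] fun ω => (B.reward t ω a : ℝ) :=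
  measurable_subtype_coe.comp ((measurable_pi_apply a).comp (B.measurable_reward_sigmaEnv t))

theorem measurable_obsInd_hist_succ : Measurable[B.hist (t + 1)] (B.obsInd t a) := by
  classical
  have h : Measurable fun i : Fin K => if (B.graph t).Adj i a then (1 : ℝ) else 0 :=
    Measurable.of_discrete
  convert (h.comp measurable_fst).comp (B.measurable_observation_hist_succ t) using 1
  funext ω
  simp [obsInd, observation]

theorem measurable_obsInd_mul_reward_hist_succ :
    Measurable[B.hist (t + 1)] fun ω => B.obsInd t a ω * (B.reward t ω a : ℝ) := by
  convert (measurable_subtype_coe.comp ((measurable_pi_apply a).comp measurable_snd)).comp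
    (B.measurable_observation_hist_succ t) using 1
  funext ω
  by_cases hadj : (B.graph t).Adj (B.action t ω) a <;> simp [obsInd, observation, hadj]

theorem obsInd_mem_Icc (ω : Ω) : B.obsInd t a ω ∈ Set.Icc (0 : ℝ) 1 := by
  unfold obsInd
  split_ifs <;> simp

open Classical in
theorem obsInd_eq_sum_choiceInd :
    B.obsInd t a
      = ∑ j ∈ Finset.univ.filter (fun j => (B.graph t).Adj j a), choiceInd (B.action t) j := by
  funext ω
  simp [obsInd, Set.indicator_apply]

end Measurability

variable [m0 : MeasurableSpace Ω] {P : Measure Ω} {B : GraphBandit K Ω} {π : ℕ → Fin K → Ω → ℝ}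

theorem hist_le (henv : B.sigmaEnv ≤ m0) (hact : ∀ t, Measurable (B.action t)) (t : ℕ) :
    B.hist t ≤ m0 := by
  classical
  refine iSup_le fun s => Measurable.comap_le ((hact s).prodMk (measurable_pi_lambda _ fun a => ?_))
  exact Measurable.ite (hact s (MeasurableSet.of_discrete (s := {i | (B.graph s).Adj i a})))
    ((measurable_pi_apply a).comp ((B.measurable_reward_sigmaEnv s).mono henv le_rfl))
    measurable_const

theorem FollowsPolicy.stronglyMeasurable_obsProb (hπ : B.FollowsPolicy P π) (t : ℕ) (a : Fin K) :
    StronglyMeasurable[B.hist t] (B.obsProb π t a) :=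
  (Finset.measurable_fun_sum _ fun j _ => hπ.adapted t j).stronglyMeasurable

/-- The shift of the conditional mean of the reward of `a` at the start of round `t` when it is
revealed that `a` is optimal. -/
noncomputable def rewardShift (B : GraphBandit K Ω) (P : Measure Ω) (t : ℕ) (a : Fin K) : Ω → ℝ :=
  meanShift P (B.hist t) (choiceInd B.optAction a) fun ω => (B.reward t ω a : ℝ)

/-- The expected entropy of the posterior distribution of the optimal action. -/
noncomputable def expEntropy (B : GraphBandit K Ω) (P : Measure Ω) (t : ℕ) : ℝ :=
  ∫ ω, shannonEntropy (fun a => B.posterior P t a ω) ∂P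

variable [IsProbabilityMeasure P]

theorem posterior_mem_Icc {t : ℕ} (hhist : B.hist t ≤ m0) (hopt : Measurable B.optAction) :
    ∀ᵐ ω ∂P, ∀ a, B.posterior P t a ω ∈ Set.Icc (0 : ℝ) 1 :=
  ae_all_iff.2 fun a => condExp_mem_Icc hhist (integrable_choiceInd hopt a)
    (ae_of_all P (choiceInd_mem_Icc B.optAction a))

theorem expEntropy_eq_sum {t : ℕ} (hhist : B.hist t ≤ m0) (hopt : Measurable B.optAction) :
    B.expEntropy P t = ∑ a, ∫ ω, Real.negMulLog (B.posterior P t a ω) ∂P := by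
  simp only [expEntropy, shannonEntropy_eq_sum_negMulLog]
  exact integral_finsetSum _ fun a _ => integrable_negMulLog_condExp hhist
    (integrable_choiceInd hopt a) (ae_of_all P (choiceInd_mem_Icc B.optAction a))

theorem expEntropy_nonneg {t : ℕ} (hhist : B.hist t ≤ m0) (hopt : Measurable B.optAction) :
    0 ≤ B.expEntropy P t := by
  refine integral_nonneg_of_ae ?_
  filter_upwards [posterior_mem_Icc hhist hopt] with ω h
  rw [shannonEntropy_eq_sum_negMulLog]
  exact Finset.sum_nonneg fun a _ => Real.negMulLog_nonneg (h a).1 (h a).2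

theorem posterior_zero (hopt : Measurable B.optAction) (a : Fin K) (ω : Ω) :
    B.posterior P 0 a ω = B.prior P a := by
  rw [posterior, show B.hist 0 = ⊥ from iSup_of_empty _, condExp_bot,
    integral_indicator_const _ (hopt (measurableSet_singleton a)), smul_eq_mul, mul_one, prior]

theorem expEntropy_zero (hopt : Measurable B.optAction) :
    B.expEntropy P 0 = shannonEntropy (B.prior P) := by
  simp [expEntropy, posterior_zero hopt]

theorem FollowsPolicy.condExp_obsInd_ae_eq_obsProb (hπ : B.FollowsPolicy P π)
    {t : ℕ} (hact : Measurable (B.action t)) (a : Fin K) :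
    P[B.obsInd t a | B.hist t ⊔ B.sigmaEnv] =ᵐ[P] B.obsProb π t a := by
  classical
  rw [obsInd_eq_sum_choiceInd]
  filter_upwards [condExp_finsetSum (fun j _ => integrable_choiceInd hact j)
    (B.hist t ⊔ B.sigmaEnv), ae_all_iff.2 fun j => hπ.sampled t j] with ω hsum hsampled
  rw [hsum, Finset.sum_apply, obsProb]
  convert Finset.sum_congr rfl fun j _ => hsampled j

theorem FollowsPolicy.memLp_top_obsProb (hπ : B.FollowsPolicy P π) (henv : B.sigmaEnv ≤ m0)
    (hact : ∀ t, Measurable (B.action t)) (t : ℕ) (a : Fin K) : MemLp (B.obsProb π t a) ⊤ P := by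
  have hobs : ∀ᵐ ω ∂P, B.obsInd t a ω ∈ Set.Icc (0 : ℝ) 1 := ae_of_all P (B.obsInd_mem_Icc t a)
  have hobs_meas := (B.measurable_obsInd_hist_succ t a).mono (hist_le henv hact _) le_rfl
  exact (memLp_congr_ae (hπ.condExp_obsInd_ae_eq_obsProb (hact t) a)).1
    (memLp_top_condExp (sup_le (hist_le henv hact t) henv)
      ((memLp_of_bounded hobs hobs_meas.aestronglyMeasurable ⊤).integrable le_top) hobs)

theorem FollowsPolicy.two_mul_sum_integral_sq_rewardShift_le (hπ : B.FollowsPolicy P π)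
    (henv : B.sigmaEnv ≤ m0) (hact : ∀ t, Measurable (B.action t))
    (hopt : Measurable[B.sigmaEnv] B.optAction) (t : ℕ) :
    2 * ∑ a, ∫ ω, B.obsProb π t a ω * B.posterior P t a ω * B.rewardShift P t a ω ^ 2 ∂P
      ≤ B.expEntropy P t - B.expEntropy P (t + 1) := by
  have hhist := hist_le henv hact
  have hopt0 := hopt.mono henv le_rfl
  rw [expEntropy_eq_sum (hhist t) hopt0, expEntropy_eq_sum (hhist (t + 1)) hopt0,
    ← Finset.sum_sub_distrib, Finset.mul_sum]
  refine Finset.sum_le_sum fun a _ => ?_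
  exact two_mul_integral_sq_meanShift_le (B.hist_le_hist_succ t) (hhist (t + 1)) le_sup_left
    (sup_le (hhist t) henv) (B.measurable_obsInd_hist_succ t a).stronglyMeasurable
    (B.measurable_obsInd_mul_reward_hist_succ t a).stronglyMeasurable
    (ae_of_all P (B.obsInd_mem_Icc t a)) (hπ.condExp_obsInd_ae_eq_obsProb (hact t) a)
    (hπ.stronglyMeasurable_obsProb t a)
    ((measurable_choiceInd hopt a).stronglyMeasurable.mono le_sup_right)
    (ae_of_all P (choiceInd_mem_Icc B.optAction a))
    ((B.measurable_coe_reward_sigmaEnv t a).stronglyMeasurable.mono le_sup_right)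
    (ae_of_all P fun ω => (B.reward t ω a).2)

theorem memLp_top_coe_reward (henv : B.sigmaEnv ≤ m0) (t : ℕ) (a : Fin K) :
    MemLp (fun ω => (B.reward t ω a : ℝ)) ⊤ P :=
  memLp_of_bounded (ae_of_all P fun ω => (B.reward t ω a).2)
    ((B.measurable_coe_reward_sigmaEnv t a).mono henv le_rfl).aestronglyMeasurable ⊤

theorem integrable_choiceInd_mul_reward (henv : B.sigmaEnv ≤ m0) {f : Ω → Fin K}
    (hf : Measurable f) (t : ℕ) (a : Fin K) :
    Integrable (fun ω => choiceInd f a ω * (B.reward t ω a : ℝ)) P :=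
  (integrable_choiceInd hf a).mul_of_top_left (memLp_top_coe_reward henv t a)

theorem integrable_reward_apply (henv : B.sigmaEnv ≤ m0) {f : Ω → Fin K} (hf : Measurable f)
    (t : ℕ) : Integrable (fun ω => (B.reward t ω (f ω) : ℝ)) P := by
  simpa only [sum_choiceInd_mul f (fun a => (B.reward t _ a : ℝ))] using
    integrable_finsetSum Finset.univ fun a _ => integrable_choiceInd_mul_reward henv hf t a

theorem integral_reward_apply (henv : B.sigmaEnv ≤ m0) {f : Ω → Fin K} (hf : Measurable f)
    (t : ℕ) : ∫ ω, (B.reward t ω (f ω) : ℝ) ∂P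
      = ∑ a, ∫ ω, choiceInd f a ω * (B.reward t ω a : ℝ) ∂P := by
  rw [← integral_finsetSum _ fun a _ => integrable_choiceInd_mul_reward henv hf t a]
  simp only [sum_choiceInd_mul f (fun a => (B.reward t _ a : ℝ))]

theorem FollowsPolicy.integral_reward_action (hπ : B.FollowsPolicy P π) (henv : B.sigmaEnv ≤ m0)
    (hact : ∀ t, Measurable (B.action t)) (t : ℕ) :
    ∫ ω, (B.reward t ω (B.action t ω) : ℝ) ∂P
      = ∑ a, ∫ ω, π t a ω * (B.reward t ω a : ℝ) ∂P := by
  rw [integral_reward_apply henv (hact t)]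
  refine Finset.sum_congr rfl fun a _ => ?_
  simp only [mul_comm _ (B.reward t _ a : ℝ)]
  exact integral_mul_eq_of_condExp_ae_eq (sup_le (hist_le henv hact t) henv)
    ((B.measurable_coe_reward_sigmaEnv t a).stronglyMeasurable.mono le_sup_right)
    (integrable_choiceInd (hact t) a)
    ((integrable_choiceInd (hact t) a).mul_of_top_right (memLp_top_coe_reward henv t a))
    (hπ.sampled t a)

theorem integral_choiceInd_optAction_mul_reward_sub (henv : B.sigmaEnv ≤ m0)
    {t : ℕ} (hhist : B.hist t ≤ m0) (hopt : Measurable B.optAction) (a : Fin K) :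
    ∫ ω, choiceInd B.optAction a ω * (B.reward t ω a : ℝ) ∂P
      - ∫ ω, B.posterior P t a ω * (B.reward t ω a : ℝ) ∂P
      = ∫ ω, B.posterior P t a ω * B.rewardShift P t a ω ∂P := by
  have hY := memLp_top_coe_reward (P := P) henv t a
  have hcov := condExp_sub_condExp_mul_sub_const hhist (P := P) (integrable_choiceInd hopt a)
    (ae_of_all P fun ω => (choiceInd_mem_Icc B.optAction a ω).1) hY.1
    (ae_of_all P fun ω => (B.reward t ω a).2) 0
  rw [← integral_sub (integrable_choiceInd_mul_reward henv hopt t a)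
    (by exact integrable_condExp.mul_of_top_left hY)]
  refine Eq.trans ?_ ((integral_condExp hhist).symm.trans (integral_congr_ae hcov))
  simp only [sub_zero, sub_mul]
  rfl

theorem IsTSN.integral_reward_sub_eq_sum (hTS : B.IsTSN P) (henv : B.sigmaEnv ≤ m0)
    (hact : ∀ t, Measurable (B.action t)) (hopt : Measurable B.optAction) (t : ℕ) :
    ∫ ω, ((B.reward t ω (B.optAction ω) : ℝ) - (B.reward t ω (B.action t ω) : ℝ)) ∂P
      = ∑ a, ∫ ω, B.posterior P t a ω * B.rewardShift P t a ω ∂P := by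
  rw [integral_sub (integrable_reward_apply henv hopt t) (integrable_reward_apply henv (hact t) t),
    integral_reward_apply henv hopt, hTS.integral_reward_action henv hact,
    ← Finset.sum_sub_distrib]
  exact Finset.sum_congr rfl fun a _ =>
    integral_choiceInd_optAction_mul_reward_sub henv (hist_le henv hact t) hopt a

theorem posterior_le_obsProb {t : ℕ} {a : Fin K} (hself : (B.graph t).Adj a a)
    (hhist : B.hist t ≤ m0) (hopt : Measurable B.optAction) :
    B.posterior P t a ≤ᵐ[P] B.obsProb (B.posterior P) t a := by
  filter_upwards [posterior_mem_Icc hhist hopt] with ω h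
  exact Finset.single_le_sum (f := fun j => B.posterior P t j ω) (fun j _ => (h j).1)
    (by simpa using hself)

theorem integral_graphQ_posterior_eq_sum {t : ℕ} (hself : ∀ i, (B.graph t).Adj i i)
    (hhist : B.hist t ≤ m0) (hopt : Measurable B.optAction)
    (hobs : ∀ a, AEStronglyMeasurable (B.obsProb (B.posterior P) t a) P) :
    ∫ ω, graphQ (B.graph t) (fun a => B.posterior P t a ω) ∂P
      = ∑ a, ∫ ω, B.posterior P t a ω / B.obsProb (B.posterior P) t a ω ∂P :=
  integral_finsetSum _ fun a _ => integrable_div_of_le integrable_condExp.1 (hobs a)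
    ((posterior_mem_Icc hhist hopt).mono fun _ h => (h a).1)
    (posterior_le_obsProb (hself a) hhist hopt)

theorem obsProb_posterior_nonneg {t : ℕ} (hhist : B.hist t ≤ m0) (hopt : Measurable B.optAction)
    (a : Fin K) : 0 ≤ᵐ[P] B.obsProb (B.posterior P) t a :=
  (posterior_mem_Icc hhist hopt).mono fun _ h => Finset.sum_nonneg fun j _ => (h j).1

theorem integral_graphQ_posterior_nonneg {t : ℕ} (hhist : B.hist t ≤ m0)
    (hopt : Measurable B.optAction) :
    0 ≤ ∫ ω, graphQ (B.graph t) (fun a => B.posterior P t a ω) ∂P := by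
  refine integral_nonneg_of_ae ?_
  filter_upwards [posterior_mem_Icc hhist hopt] with ω h using graphQ_nonneg fun a => (h a).1

theorem integral_posterior_div_obsProb_nonneg {t : ℕ} (hhist : B.hist t ≤ m0)
    (hopt : Measurable B.optAction) (a : Fin K) :
    0 ≤ ∫ ω, B.posterior P t a ω / B.obsProb (B.posterior P) t a ω ∂P := by
  refine integral_nonneg_of_ae ?_
  filter_upwards [posterior_mem_Icc hhist hopt, obsProb_posterior_nonneg hhist hopt a]
    with ω hα hq using div_nonneg (hα a).1 hq

theorem integral_obsProb_mul_sq_rewardShift_nonneg {t : ℕ} (hhist : B.hist t ≤ m0)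
    (hopt : Measurable B.optAction) (a : Fin K) :
    0 ≤ ∫ ω, B.obsProb (B.posterior P) t a ω * B.posterior P t a ω
      * B.rewardShift P t a ω ^ 2 ∂P := by
  refine integral_nonneg_of_ae ?_
  filter_upwards [posterior_mem_Icc hhist hopt, obsProb_posterior_nonneg hhist hopt a]
    with ω hα hq using mul_nonneg (mul_nonneg hq (hα a).1) (sq_nonneg _)

theorem IsTSN.expEntropy_succ_le (hTS : B.IsTSN P) (henv : B.sigmaEnv ≤ m0)
    (hact : ∀ t, Measurable (B.action t)) (hopt : Measurable[B.sigmaEnv] B.optAction) (t : ℕ) :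
    B.expEntropy P (t + 1) ≤ B.expEntropy P t := by
  have hgain := hTS.two_mul_sum_integral_sq_rewardShift_le henv hact hopt t
  have hnonneg := Finset.sum_nonneg fun a (_ : a ∈ Finset.univ) =>
    integral_obsProb_mul_sq_rewardShift_nonneg (P := P) (hist_le henv hact t)
      (hopt.mono henv le_rfl) a
  linarith

theorem IsTSN.integral_posterior_mul_rewardShift_le (hTS : B.IsTSN P)
    (henv : B.sigmaEnv ≤ m0) (hact : ∀ t, Measurable (B.action t))
    (hopt : Measurable B.optAction) {t : ℕ} {a : Fin K} (hself : (B.graph t).Adj a a) :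
    ∫ ω, B.posterior P t a ω * B.rewardShift P t a ω ∂P
      ≤ √(∫ ω, B.posterior P t a ω / B.obsProb (B.posterior P) t a ω ∂P)
        * √(∫ ω, B.obsProb (B.posterior P) t a ω * B.posterior P t a ω
          * B.rewardShift P t a ω ^ 2 ∂P) := by
  have hhist := hist_le henv hact
  have hopt_mem := ae_of_all P (choiceInd_mem_Icc B.optAction a)
  have hopt_int : Integrable (choiceInd B.optAction a) P := integrable_choiceInd hopt a
  exact integral_mul_le_sqrt_integral_div_mul_sqrt
    (memLp_top_condExp (hhist t) hopt_int hopt_mem)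
    (hTS.memLp_top_obsProb henv hact t a)
    (memLp_top_meanShift (hhist t) hopt_int (hopt_mem.mono fun _ h => h.1)
      (memLp_top_coe_reward henv t a).1 (ae_of_all P fun ω => (B.reward t ω a).2))
    ((posterior_mem_Icc (hhist t) hopt).mono fun _ h => (h a).1)
    (posterior_le_obsProb hself (hhist t) hopt)

theorem IsTSN.integral_reward_sub_le (hTS : B.IsTSN P) (henv : B.sigmaEnv ≤ m0)
    (hact : ∀ t, Measurable (B.action t)) (hopt : Measurable[B.sigmaEnv] B.optAction) {t : ℕ}
    (hself : ∀ i, (B.graph t).Adj i i) :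
    ∫ ω, ((B.reward t ω (B.optAction ω) : ℝ) - (B.reward t ω (B.action t ω) : ℝ)) ∂P
      ≤ √(∫ ω, graphQ (B.graph t) (fun a => B.posterior P t a ω) ∂P)
        * √((B.expEntropy P t - B.expEntropy P (t + 1)) / 2) := by
  have hhist := hist_le henv hact
  have hopt0 := hopt.mono henv le_rfl
  have hgain := hTS.two_mul_sum_integral_sq_rewardShift_le henv hact hopt t
  rw [hTS.integral_reward_sub_eq_sum henv hact hopt0,
    integral_graphQ_posterior_eq_sum hself (hhist t) hopt0 fun a =>
      (hTS.memLp_top_obsProb henv hact t a).1]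
  refine (Finset.sum_le_sum fun a _ => hTS.integral_posterior_mul_rewardShift_le henv
    hact hopt0 (hself a)).trans ((Real.sum_sqrt_mul_sqrt_le _
      (integral_posterior_div_obsProb_nonneg (hhist t) hopt0)
      (integral_obsProb_mul_sq_rewardShift_nonneg (hhist t) hopt0)).trans ?_)
  gcongr
  linarith

theorem bayesRegret_eq_sum (henv : B.sigmaEnv ≤ m0) (hact : ∀ t, Measurable (B.action t))
    (hopt : Measurable B.optAction) (T : ℕ) :
    B.bayesRegret P T = ∑ t ∈ Finset.range T,
      ∫ ω, ((B.reward t ω (B.optAction ω) : ℝ) - (B.reward t ω (B.action t ω) : ℝ)) ∂P :=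
  integral_finsetSum _ fun t _ =>
    (integrable_reward_apply henv hopt t).sub (integrable_reward_apply henv (hact t) t)

theorem sigmaEnv_le (hpstar : Measurable B.pstar) (hreward : ∀ t, Measurable (B.reward t)) :
    B.sigmaEnv ≤ m0 :=
  sup_le hpstar.comap_le (iSup_le fun t => (hreward t).comap_le)

end GraphBandit

open GraphBandit in
theorem mainTheorem3_general {K : ℕ} {Ω : Type*} [MeasurableSpace Ω] (P : Measure Ω)
    [IsProbabilityMeasure P] (B : GraphBandit K Ω) (hself : ∀ t i, (B.graph t).Adj i i)
    (hpstar : Measurable B.pstar) (hreward : ∀ t, Measurable (B.reward t))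
    (hact : ∀ t, Measurable (B.action t)) (hopt : Measurable[B.sigmaEnv] B.optAction)
    (hTS : B.IsTSN P) (T : ℕ) :
    B.bayesRegret P T ≤
      √(1 / 2 * (∑ t ∈ Finset.range T,
        ∫ ω, graphQ (B.graph t) (fun a => B.posterior P t a ω) ∂P) *
        shannonEntropy (B.prior P)) := by
  have henv := sigmaEnv_le hpstar hreward
  have hopt0 := hopt.mono henv le_rfl
  have hQ : ∀ t, 0 ≤ ∫ ω, graphQ (B.graph t) (fun a => B.posterior P t a ω) ∂P :=
    fun t => integral_graphQ_posterior_nonneg (hist_le henv hact t) hopt0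
  set Q := fun t => ∫ ω, graphQ (B.graph t) (fun a => B.posterior P t a ω) ∂P
  calc B.bayesRegret P T
      ≤ ∑ t ∈ Finset.range T, √(Q t) * √((B.expEntropy P t - B.expEntropy P (t + 1)) / 2) :=
        (bayesRegret_eq_sum henv hact hopt0 T).trans_le <| Finset.sum_le_sum fun t _ =>
          hTS.integral_reward_sub_le henv hact hopt (hself t)
    _ ≤ √(∑ t ∈ Finset.range T, Q t) *
          √(∑ t ∈ Finset.range T, (B.expEntropy P t - B.expEntropy P (t + 1)) / 2) :=
        Real.sum_sqrt_mul_sqrt_le _ hQ fun t =>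
          div_nonneg (sub_nonneg.2 (hTS.expEntropy_succ_le henv hact hopt t)) two_pos.le
    _ ≤ √(∑ t ∈ Finset.range T, Q t) * √(shannonEntropy (B.prior P) / 2) := by
        rw [← Finset.sum_div, Finset.sum_range_sub', expEntropy_zero hopt0]
        gcongr
        exact sub_le_self _ (expEntropy_nonneg (hist_le henv hact T) hopt0)
    _ = √(1 / 2 * (∑ t ∈ Finset.range T, Q t) * shannonEntropy (B.prior P)) := by
        rw [← Real.sqrt_mul (Finset.sum_nonneg fun t _ => hQ t)]
        congr 1
        ring

theorem mainTheorem3 {K : ℕ} {Ω : Type*} [MeasurableSpace Ω] (P : Measure Ω)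
    [IsProbabilityMeasure P] (B : GraphBandit K Ω) (hB : B.IsBayesian P) (hTS : B.IsTSN P)
    (T : ℕ) :
    B.bayesRegret P T ≤
      Real.sqrt ((1 / 2 : ℝ) *
        (∑ t ∈ Finset.range T, ∫ ω, graphQ (B.graph t) (fun a => B.posterior P t a ω) ∂P) *
        shannonEntropy (B.prior P)) :=
  mainTheorem3_general P B hB.adj_self hB.measurable_pstar hB.measurable_reward
    hB.measurable_action (hB.measurable_optAction.mono le_sup_left le_rfl) hTS T
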